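/- Let $m,n\ge 1$ and let $A=\begin{pmatrix}A_{11}&A_{12}\\A_{21}&A_{22}\end{pmatrix}$ be a real symmetric positive definite matrix with $A_{11}\in\mathbb R^{m\times m}$ and $A_{22}\in\mathbb R^{n\times n}$. (The Cholesky factor of a symmetric positive definite matrix $M$ is the lower triangular matrix $R$ with positive diagonal and $M=RR^T$.) Let $L_1,L_2$ be the Cholesky factors of $A_{11},A_{22}$, and let $C=L_1^{-1}A_{12}L_2^{-T}\in\mathbb R^{m\times n}$. Let $C=U\Sigma V^T$ be a full singular value decomposition with $U,V$ orthogonal and singular values $\sigma_1\ge\sigma_2\ge\cdots\ge\sigma_{\min\{m,n\}}\ge 0$ on the diagonal of the rectangular diagonal matrix $\Sigma$; set $\sigma_i=0$ for $i>\min\{m,n\}$. Let $0\le r\le\min\{m,n\}$, let $V_1$ consist of the first $r$ columns of $V$, let $\Sigma_1=\operatorname{diag}(\sigma_1,\dots,\sigma_r)$, and let $\tau$ satisfy $\sigma_r\ge\tau\ge\sigma_{r+1}$ (only $\tau\ge\sigma_{1}$ if $r=0$). All norms are spectral norms. Then $I-V_1\Sigma_1^2V_1^T$ is positive definite. Let $\tilde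 D_2$ be its Cholesky factor, and put $$\tilde L=\begin{pmatrix}L_1&0\\L_2C^T&L_2\end{pmatrix}\begin{pmatrix}I&0\\0&\tilde D_2\end{pmatrix},\qquad \tilde A=\tilde L\tilde L^T .$$ 1. $\tilde A=A+E$, where $E$ is positive semidefinite and $$\frac{\|E\|_2}{\|A\|_2}\le\sigma_{r+1}^2\le\tau^2 .$$ 2. If $L$ is the Cholesky factor of $A$, then $$\frac{\|\tilde L-L\|_2}{\|L\|_2}\le\frac{c\sqrt{1-\sigma_n^2}}{1-\sigma_1^2}\,\tau^2,\qquad c=1+2\lceil\log_2 n\rceil,$$ where $\sigma_n$ is the $n$-th singular value of $C$ if $m\ge n$, and $\sigma_n=0$ otherwise. 3. If instead $\tilde D_2$ in $\tilde L$ is replaced by the positive semidefinite square root $(I-V_1\Sigma_1^2V_1^T)^{1/2}$ and $L$ is replaced by $L=\begin{pmatrix}L_1&0\\L_2C^T&L_2(I-V\Sigma^T\Sigma V^T)^{1/2}\end{pmatrix}$, then $A=LL^T$ still holds and, provided that $\tau>0$, $$\frac{\|\tilde L-L\|_2}{\|L\|_2}<\tau^2 .$$ -/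

import Mathlib

open scoped Matrix Matrix.Norms.L2Operator MatrixOrder

noncomputable section

namespace ESIF

/-- The block matrix with blocks `P, Q, R, S`, with rows and columns indexed by `Fin (m + n)`. -/
def glue {m n : ℕ} (P : Matrix (Fin m) (Fin m) ℝ) (Q : Matrix (Fin m) (Fin n) ℝ)
    (R : Matrix (Fin n) (Fin m) ℝ) (S : Matrix (Fin n) (Fin n) ℝ) :
    Matrix (Fin (m + n)) (Fin (m + n)) ℝ :=
  Matrix.reindex finSumFinEquiv finSumFinEquiv (Matrix.fromBlocks P Q R S)

/-- The leading `m × m` block of `A`. -/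
def block11 {m n : ℕ} (A : Matrix (Fin (m + n)) (Fin (m + n)) ℝ) : Matrix (Fin m) (Fin m) ℝ :=
  A.submatrix (Fin.castAdd n) (Fin.castAdd n)

/-- The upper right `m × n` block of `A`. -/
def block12 {m n : ℕ} (A : Matrix (Fin (m + n)) (Fin (m + n)) ℝ) : Matrix (Fin m) (Fin n) ℝ :=
  A.submatrix (Fin.castAdd n) (Fin.natAdd m)

/-- The trailing `n × n` block of `A`. -/
def block22 {m n : ℕ} (A : Matrix (Fin (m + n)) (Fin (m + n)) ℝ) : Matrix (Fin n) (Fin n) ℝ :=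
  A.submatrix (Fin.natAdd m) (Fin.natAdd m)

/-- `L` is the lower triangular Cholesky factor of `M`: it is lower triangular with positive
diagonal entries, and `M = L * Lᵀ`. -/
structure IsCholesky {k : ℕ} (M L : Matrix (Fin k) (Fin k) ℝ) : Prop where
  lower : ∀ i j, i < j → L i j = 0
  diag_pos : ∀ i, 0 < L i i
  eq_mul : M = L * Lᵀ

/-- The scaled off-diagonal block `C = L₁⁻¹ A₁₂ L₂⁻ᵀ`. -/
def scaledBlock {m n : ℕ} (A : Matrix (Fin (m + n)) (Fin (m + n)) ℝ)
    (L₁ : Matrix (Fin m) (Fin m) ℝ) (L₂ : Matrix (Fin n) (Fin n) ℝ) :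
    Matrix (Fin m) (Fin n) ℝ :=
  L₁⁻¹ * block12 A * (L₂⁻¹)ᵀ

/-- The singular values of `C` in nonincreasing order, indexed from `0` and continued by zeros:
`sv C i` is the `(i + 1)`-st singular value of `C`. -/
def sv {m n : ℕ} (C : Matrix (Fin m) (Fin n) ℝ) (i : ℕ) : ℝ :=
  (Matrix.toEuclideanLin C).singularValues i

/-- The rectangular diagonal `m × n` matrix with diagonal entries `s 0, s 1, …`. -/
def rectDiag (m n : ℕ) (s : ℕ → ℝ) : Matrix (Fin m) (Fin n) ℝ :=
  Matrix.of fun i j => if (i : ℕ) = (j : ℕ) then s i else 0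

/-- `C = U Σ Vᵀ` is a full singular value decomposition of `C`. -/
structure IsSVD {m n : ℕ} (C : Matrix (Fin m) (Fin n) ℝ) (U : Matrix (Fin m) (Fin m) ℝ)
    (V : Matrix (Fin n) (Fin n) ℝ) : Prop where
  left_orthogonal : U ∈ Matrix.orthogonalGroup (Fin m) ℝ
  right_orthogonal : V ∈ Matrix.orthogonalGroup (Fin n) ℝ
  eq_mul : C = U * rectDiag m n (sv C) * Vᵀ

/-- The matrix `I - V₁ Σ₁² V₁ᵀ`, where `V₁` holds the first `r` columns of `V` and
`Σ₁ = diag (σ₁, …, σᵣ)` holds the `r` largest singular values of `C`. -/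
def truncGram {m n : ℕ} (C : Matrix (Fin m) (Fin n) ℝ) (V : Matrix (Fin n) (Fin n) ℝ)
    {r : ℕ} (hr : r ≤ n) : Matrix (Fin n) (Fin n) ℝ :=
  let V₁ : Matrix (Fin n) (Fin r) ℝ := V.submatrix id (Fin.castLE hr)
  let S₁ : Matrix (Fin r) (Fin r) ℝ := Matrix.diagonal fun i => sv C i
  1 - V₁ * S₁ ^ 2 * V₁ᵀ

/-- The matrix `I - V Σᵀ Σ Vᵀ`, with all the singular values of `C`. -/
def fullGram {m n : ℕ} (C : Matrix (Fin m) (Fin n) ℝ) (V : Matrix (Fin n) (Fin n) ℝ) :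
    Matrix (Fin n) (Fin n) ℝ :=
  1 - V * (rectDiag m n (sv C))ᵀ * rectDiag m n (sv C) * Vᵀ

/-- The factor `[L₁, 0; L₂ Cᵀ, L₂] * diag (I, D)`. -/
def factor {m n : ℕ} (L₁ : Matrix (Fin m) (Fin m) ℝ) (L₂ : Matrix (Fin n) (Fin n) ℝ)
    (C : Matrix (Fin m) (Fin n) ℝ) (D : Matrix (Fin n) (Fin n) ℝ) :
    Matrix (Fin (m + n)) (Fin (m + n)) ℝ :=
  glue L₁ 0 (L₂ * Cᵀ) L₂ * glue 1 0 0 D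

end ESIF

end

/-!
With `W = 1 - Cᵀ C` one has `A = F * diag (1, W) * Fᵀ` for `F = [L₁, 0; L₂ Cᵀ, L₂]`, so `W` is
positive definite, and the matrix `factor L₁ L₂ C D` is a square root of `A` with `W` replaced by
`D Dᵀ` (`factor_mul_transpose`). Both `W` and `1 - V₁ Σ₁² V₁ᵀ` are diagonalized by `V`, with
eigenvalues `1 - σⱼ²` and `1 - σⱼ²` or `1` (`fullGram_eq`, `truncGram_eq`). Hence `0 < 1 - σⱼ²`,
and the difference of the two, which gives `E` after multiplication by `L₂` and `L₂ᵀ`, has the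
eigenvalues `0` and `σⱼ²` with `r < j` (counting from `1`). Together with `‖L₂‖² = ‖A₂₂‖ ≤ ‖A‖`
this bounds `E`. For the square roots the eigenvalues of the difference are
`1 - √(1 - σⱼ²) < τ²`.

For the Cholesky factors a perturbation theorem without a smallness assumption is needed
(`IsCholesky.norm_sub_le`). If `L` and `L'` are the Cholesky factors of `H` and `H'`, and
`M = (L + L') / 2`, then `M⁻¹ (L' - L)` is the lower triangular truncation of
`M⁻¹ (H' - H) M⁻ᵀ` (`IsCholesky.sub_eq`). This identity yields uniqueness, and, since Cholesky
factors are continuous by compactness, the derivative along a segment `H + t K`, which is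
`L * low (L⁻¹ K L⁻ᵀ)`. The truncation `low` has norm at most `1 / 2 + k` on matrices of size
`n ≤ 2 ^ k`: the strictly lower triangular part is a sum of `k` pinchings, one for each dyadic
level (`norm_low_le`). The mean value inequality concludes, except when `1 - σₙ² < 1 / 4`: then the
claimed bound is larger than the sum of the norms of the two factors
(`norm_cholesky_trunc_sub_le`).
-/

namespace ESIF

/-! ### Spectral norm of the triangular truncation -/

theorem norm_le_of_sum_sq_mulVec_le {ι κ : Type*} [Fintype ι] [Fintype κ] [DecidableEq κ]
    (K : Matrix ι κ ℝ) {c : ℝ} (hc : 0 ≤ c)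
    (h : ∀ x : κ → ℝ, ∑ i, (K *ᵥ x) i ^ 2 ≤ c ^ 2 * ∑ j, x j ^ 2) : ‖K‖ ≤ c := by
  rw [Matrix.l2_opNorm_def]
  refine ContinuousLinearMap.opNorm_le_bound _ hc fun x => ?_
  refine le_of_sq_le_sq ?_ (by positivity)
  rw [mul_pow, EuclideanSpace.real_norm_sq_eq, EuclideanSpace.real_norm_sq_eq]
  exact h x.ofLp

theorem sum_sq_mulVec_le {ι κ : Type*} [Fintype ι] [Fintype κ] [DecidableEq κ]
    (K : Matrix ι κ ℝ) (x : κ → ℝ) :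
    ∑ i, (K *ᵥ x) i ^ 2 ≤ ‖K‖ ^ 2 * ∑ j, x j ^ 2 := by
  have h := Matrix.l2_opNorm_mulVec K (WithLp.toLp 2 x)
  have h2 := pow_le_pow_left₀ (norm_nonneg _) h 2
  rw [mul_pow, EuclideanSpace.real_norm_sq_eq, EuclideanSpace.real_norm_sq_eq] at h2
  exact h2

/-- Pinching: keep the entries of `K` whose row label equals their column label, and replace the
others by zero. -/
noncomputable def pinch {ι κ : Type*} (g : ι → ℤ) (h : κ → ℤ) (K : Matrix ι κ ℝ) :
    Matrix ι κ ℝ :=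
  Matrix.of fun i j => if g i = h j then K i j else 0

/-- A pinching is, up to permutations of rows and columns, a direct sum of submatrices. -/
theorem norm_pinch_le {ι κ : Type*} [Fintype ι] [Fintype κ] [DecidableEq κ]
    (g : ι → ℤ) (h : κ → ℤ) (K : Matrix ι κ ℝ) : ‖pinch g h K‖ ≤ ‖K‖ := by
  classical
  refine norm_le_of_sum_sq_mulVec_le _ (norm_nonneg _) fun x => ?_
  let y : ℤ → κ → ℝ := fun c j => if c = h j then x j else 0
  have hy : ∀ i, (pinch g h K *ᵥ x) i = (K *ᵥ y (g i)) i := by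
    intro i
    simp only [Matrix.mulVec, dotProduct, pinch, Matrix.of_apply, y]
    exact Finset.sum_congr rfl fun j _ => by split_ifs <;> simp
  set S := Finset.univ.image g
  calc ∑ i, (pinch g h K *ᵥ x) i ^ 2 = ∑ i, (K *ᵥ y (g i)) i ^ 2 := by simp only [hy]
    _ = ∑ c ∈ S, ∑ i with g i = c, (K *ᵥ y (g i)) i ^ 2 :=
        (Finset.sum_fiberwise_of_maps_to (fun i _ => Finset.mem_image_of_mem g (Finset.mem_univ i))
          _).symm
    _ ≤ ∑ c ∈ S, ∑ i, (K *ᵥ y c) i ^ 2 := by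
        refine Finset.sum_le_sum fun c _ => ?_
        rw [Finset.sum_filter]
        refine Finset.sum_le_sum fun i _ => ?_
        split_ifs with hc
        · rw [hc]
        · positivity
    _ ≤ ∑ c ∈ S, ‖K‖ ^ 2 * ∑ j, y c j ^ 2 :=
        Finset.sum_le_sum fun c _ => sum_sq_mulVec_le K _
    _ = ‖K‖ ^ 2 * ∑ j, ∑ c ∈ S, y c j ^ 2 := by
        rw [← Finset.mul_sum, Finset.sum_comm]
    _ ≤ ‖K‖ ^ 2 * ∑ j, x j ^ 2 := by
        refine mul_le_mul_of_nonneg_left (Finset.sum_le_sum fun j _ => ?_) (by positivity)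
        simp only [y, ite_pow, ne_eq, OfNat.ofNat_ne_zero, not_false_eq_true, zero_pow]
        rw [Finset.sum_ite_eq']
        split_ifs
        · exact le_rfl
        · positivity

/-- Two distinct numbers below `2 ^ k` are separated at exactly one dyadic level: there they lie in
the two halves of a common block. -/
theorem sum_dyadic_indicator (k : ℕ) : ∀ i j : ℕ, i < 2 ^ k → j < 2 ^ k →
    ∑ l ∈ Finset.range k, (if i / 2 ^ l = j / 2 ^ l + 1 ∧ Even (j / 2 ^ l) then (1 : ℝ) else 0) =
      if j < i then 1 else 0 := by
  induction k with
  | zero =>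
    intro i j hi hj
    have : ¬ j < i := by simp at hi; omega
    simp [this]
  | succ k ih =>
    intro i j hi hj
    have hdiv : ∀ a l : ℕ, a / 2 ^ (l + 1) = a / 2 / 2 ^ l := fun a l => by
      rw [pow_succ', Nat.div_div_eq_div_mul]
    rw [Finset.sum_range_succ']
    simp only [hdiv, pow_zero, Nat.div_one]
    rw [ih (i / 2) (j / 2) (by omega) (by omega)]
    simp only [Nat.even_iff]
    split_ifs <;> first | omega | norm_num

/-- Lower triangular truncation: the strictly lower triangular part plus half the diagonal. For
symmetric `K` it is the unique lower triangular `Y` with `Y + Yᵀ = K`. -/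
noncomputable def low {n : ℕ} (K : Matrix (Fin n) (Fin n) ℝ) : Matrix (Fin n) (Fin n) ℝ :=
  Matrix.of fun i j => if j < i then K i j else if i = j then K i j / 2 else 0

theorem eq_low_of_add_transpose {n : ℕ} {Y K : Matrix (Fin n) (Fin n) ℝ}
    (hY : ∀ i j, i < j → Y i j = 0) (h : Y + Yᵀ = K) : Y = low K := by
  ext i j
  have hij : Y i j + Y j i = K i j := by rw [← h]; rfl
  simp only [low, Matrix.of_apply]
  split_ifs with h1 h2
  · rw [← hij, hY j i h1, add_zero]
  · subst h2
    linarith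
  · exact hY i j (by omega)

/-- Each of the `k` dyadic levels contributes a pinching of `K`, and so does the diagonal. -/
theorem norm_low_le {n : ℕ} (k : ℕ) (hk : n ≤ 2 ^ k) (K : Matrix (Fin n) (Fin n) ℝ) :
    ‖low K‖ ≤ (1 / 2 + k) * ‖K‖ := by
  let g : ℕ → Fin n → ℤ := fun l i => ((i : ℕ) / 2 ^ l : ℕ)
  -- The label `-1` matches no row.
  let h : ℕ → Fin n → ℤ := fun l j =>
    if Even ((j : ℕ) / 2 ^ l) then ((j : ℕ) / 2 ^ l : ℕ) + 1 else -1
  have hlow : low K = (1 / 2 : ℝ) • pinch (g 0) (g 0) K +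
      ∑ l ∈ Finset.range k, pinch (g l) (h l) K := by
    ext i j
    have hterm : ∀ l, pinch (g l) (h l) K i j =
        (if (i : ℕ) / 2 ^ l = (j : ℕ) / 2 ^ l + 1 ∧ Even ((j : ℕ) / 2 ^ l) then (1 : ℝ) else 0) *
          K i j := by
      intro l
      simp only [pinch, Matrix.of_apply, g, h]
      by_cases he : Even ((j : ℕ) / 2 ^ l)
      · simp only [he, if_true, and_true, ite_mul, one_mul, zero_mul]
        congr 1
        simp only [eq_iff_iff]
        omega
      · simp only [he, if_false, and_false, zero_mul]
        have : ((i : ℕ) / 2 ^ l : ℕ) ≠ (-1 : ℤ) := by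
          have := Int.natCast_nonneg ((i : ℕ) / 2 ^ l)
          linarith
        rw [if_neg this]
    rw [Matrix.add_apply, Matrix.sum_apply]
    simp only [hterm]
    rw [← Finset.sum_mul, sum_dyadic_indicator k i j (i.isLt.trans_le hk) (j.isLt.trans_le hk)]
    simp only [low, pinch, g, Matrix.smul_apply, Matrix.of_apply, smul_eq_mul, pow_zero,
      Nat.div_one, Fin.lt_def, Fin.ext_iff, Nat.cast_inj]
    split_ifs <;> first | omega | ring
  rw [hlow]
  calc _ ≤ ‖(1 / 2 : ℝ) • pinch (g 0) (g 0) K‖ + ‖∑ l ∈ Finset.range k, pinch (g l) (h l) K‖ :=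
        norm_add_le _ _
    _ ≤ 1 / 2 * ‖K‖ + ∑ l ∈ Finset.range k, ‖K‖ := by
        gcongr
        · rw [norm_smul, Real.norm_of_nonneg (by norm_num)]
          exact mul_le_mul_of_nonneg_left (norm_pinch_le _ _ K) (by norm_num)
        · exact norm_sum_le_of_le _ fun l _ => norm_pinch_le _ _ K
    _ = _ := by rw [Finset.sum_const, Finset.card_range, nsmul_eq_mul]; ring

/-! ### Perturbation of the Cholesky factor -/

open Filter Topology

theorem inv_apply_eq_zero_of_lower {n : ℕ} {M : Matrix (Fin n) (Fin n) ℝ} (hdet : IsUnit M.det)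
    (hM : ∀ i j, i < j → M i j = 0) (i j : Fin n) (hij : i < j) : M⁻¹ i j = 0 := by
  let _ := M.invertibleOfIsUnitDet hdet
  have hM' : M.IsLowerTriangular := fun i j h => hM i j (OrderDual.toDual_lt_toDual.1 h)
  exact Matrix.blockTriangular_inv_of_blockTriangular hM' (OrderDual.toDual_lt_toDual.2 hij)

theorem mul_apply_eq_zero_of_lower {n : ℕ} {M N : Matrix (Fin n) (Fin n) ℝ}
    (hM : ∀ i j, i < j → M i j = 0) (hN : ∀ i j, i < j → N i j = 0) (i j : Fin n) (hij : i < j) :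
    (M * N) i j = 0 := by
  have hM' : M.IsLowerTriangular := fun i j h => hM i j (OrderDual.toDual_lt_toDual.1 h)
  have hN' : N.IsLowerTriangular := fun i j h => hN i j (OrderDual.toDual_lt_toDual.1 h)
  exact hM'.mul hN' (OrderDual.toDual_lt_toDual.2 hij)

theorem isUnit_det_of_lower {n : ℕ} {M : Matrix (Fin n) (Fin n) ℝ}
    (hM : ∀ i j, i < j → M i j = 0) (hd : ∀ i, 0 < M i i) : IsUnit M.det := by
  have hM' : M.IsLowerTriangular := fun i j h => hM i j (OrderDual.toDual_lt_toDual.1 h)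
  rw [Matrix.det_of_isLowerTriangular M hM']
  exact (Finset.prod_pos fun i _ => hd i).ne'.isUnit

theorem IsCholesky.isUnit_det {n : ℕ} {H L : Matrix (Fin n) (Fin n) ℝ} (h : IsCholesky H L) :
    IsUnit L.det :=
  isUnit_det_of_lower h.lower h.diag_pos

/-- Exact difference formula for Cholesky factors: with the midpoint `M = (L + L') / 2` one has
`M Δᵀ + Δ Mᵀ = H' - H` for `Δ = L' - L`, so the lower triangular matrix `M⁻¹ Δ` is determined by
its symmetric part. -/
theorem IsCholesky.sub_eq {n : ℕ} {H H' L L' : Matrix (Fin n) (Fin n) ℝ}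
    (h : IsCholesky H L) (h' : IsCholesky H' L') :
    L' - L = ((1 / 2 : ℝ) • (L + L')) *
      low (((1 / 2 : ℝ) • (L + L'))⁻¹ * (H' - H) * (((1 / 2 : ℝ) • (L + L'))⁻¹)ᵀ) := by
  set M := (1 / 2 : ℝ) • (L + L') with hMdef
  have hMl : ∀ i j, i < j → M i j = 0 := fun i j hij => by
    simp [hMdef, h.lower i j hij, h'.lower i j hij]
  have hMd : ∀ i, 0 < M i i := fun i => by
    have := h.diag_pos i
    have := h'.diag_pos i
    simp only [hMdef, Matrix.smul_apply, Matrix.add_apply, smul_eq_mul]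
    positivity
  have hu := isUnit_det_of_lower hMl hMd
  have hΔ : ∀ i j, i < j → (L' - L) i j = 0 := fun i j hij => by
    simp [h.lower i j hij, h'.lower i j hij]
  have hsum : M * (L' - L)ᵀ + (L' - L) * Mᵀ = H' - H := by
    rw [h.eq_mul, h'.eq_mul, hMdef]
    simp only [Matrix.transpose_sub, Matrix.transpose_smul, Matrix.transpose_add, Matrix.smul_mul,
      Matrix.mul_smul, Matrix.add_mul, Matrix.mul_add, Matrix.mul_sub, Matrix.sub_mul]
    module
  have hY : M⁻¹ * (L' - L) = low (M⁻¹ * (H' - H) * (M⁻¹)ᵀ) := by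
    refine eq_low_of_add_transpose
      (mul_apply_eq_zero_of_lower (inv_apply_eq_zero_of_lower hu hMl) hΔ) ?_
    have h1 : Mᵀ * (M⁻¹)ᵀ = 1 := by
      rw [← Matrix.transpose_mul, Matrix.nonsing_inv_mul _ hu, Matrix.transpose_one]
    rw [← hsum, Matrix.mul_add, Matrix.add_mul, ← Matrix.mul_assoc, Matrix.nonsing_inv_mul _ hu,
      Matrix.one_mul, Matrix.mul_assoc M⁻¹, Matrix.mul_assoc _ Mᵀ, h1, Matrix.mul_one,
      Matrix.transpose_mul, add_comm]
  rw [← hY, ← Matrix.mul_assoc, Matrix.mul_nonsing_inv _ hu, Matrix.one_mul]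

theorem low_zero {n : ℕ} : low (0 : Matrix (Fin n) (Fin n) ℝ) = 0 := by
  ext i j
  simp [low]

theorem IsCholesky.unique {n : ℕ} {H L L' : Matrix (Fin n) (Fin n) ℝ}
    (h : IsCholesky H L) (h' : IsCholesky H L') : L' = L := by
  have := h.sub_eq h'
  rwa [sub_self, Matrix.mul_zero, Matrix.zero_mul, low_zero, Matrix.mul_zero, sub_eq_zero] at this

theorem continuous_low {n : ℕ} :
    Continuous (low : Matrix (Fin n) (Fin n) ℝ → Matrix (Fin n) (Fin n) ℝ) := by
  refine continuous_matrix fun i j => ?_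
  simp only [low, Matrix.of_apply]
  split_ifs <;> fun_prop

theorem norm_mul_transpose_self {m n : ℕ} (L : Matrix (Fin m) (Fin n) ℝ) :
    ‖L * Lᵀ‖ = ‖L‖ ^ 2 := by
  have h := Matrix.l2_opNorm_conjTranspose_mul_self Lᴴ
  rwa [Matrix.conjTranspose_conjTranspose, Matrix.l2_opNorm_conjTranspose, ← sq,
    Matrix.conjTranspose_eq_transpose_of_trivial] at h

theorem norm_transpose {m n : ℕ} (L : Matrix (Fin m) (Fin n) ℝ) : ‖Lᵀ‖ = ‖L‖ := by
  rw [← Matrix.conjTranspose_eq_transpose_of_trivial, Matrix.l2_opNorm_conjTranspose]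

theorem IsCholesky.norm_sq {n : ℕ} {H L : Matrix (Fin n) (Fin n) ℝ} (h : IsCholesky H L) :
    ‖L‖ ^ 2 = ‖H‖ := by
  rw [h.eq_mul, norm_mul_transpose_self]

/-- Cholesky factors depend continuously on the matrix: they are locally bounded, and every limit
point of them is again a Cholesky factor, hence unique. -/
theorem IsCholesky.continuousWithinAt {n : ℕ} {H L : ℝ → Matrix (Fin n) (Fin n) ℝ} {s : Set ℝ}
    (hs : ∀ t ∈ s, IsCholesky (H t) (L t)) {t : ℝ} (ht : t ∈ s) (hH : ContinuousWithinAt H s t) :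
    ContinuousWithinAt L s t := by
  have : ProperSpace (Matrix (Fin n) (Fin n) ℝ) := FiniteDimensional.proper_real _
  refine (isCompact_closedBall (0 : Matrix (Fin n) (Fin n) ℝ)
    (√(‖H t‖ + 1))).tendsto_nhds_of_unique_mapClusterPt ?_ ?_
  · have hlt : ∀ᶠ y in 𝓝[s] t, ‖H y‖ < ‖H t‖ + 1 :=
      hH.norm.eventually_lt tendsto_const_nhds (lt_add_one _)
    filter_upwards [hlt, self_mem_nhdsWithin] with y hy hys
    rw [mem_closedBall_zero_iff]
    refine Real.le_sqrt_of_sq_le ?_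
    rw [(hs y hys).norm_sq]
    exact hy.le
  · intro X _ hX
    obtain ⟨F, hF, hFX⟩ := mapClusterPt_iff_ultrafilter.1 hX
    have hent : ∀ i j, Tendsto (fun y => L y i j) F (𝓝 (X i j)) := fun i j =>
      ((continuous_id.matrix_elem i j).tendsto X).comp hFX
    have hmem : ∀ᶠ y in (F : Filter ℝ), y ∈ s := hF self_mem_nhdsWithin
    have hlow : ∀ i j, i < j → X i j = 0 := fun i j hij =>
      tendsto_nhds_unique_of_eventuallyEq (hent i j) tendsto_const_nhds
        (hmem.mono fun y hy => (hs y hy).lower i j hij)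
    have hnonneg : ∀ i, 0 ≤ X i i := fun i =>
      ge_of_tendsto (hent i i) (hmem.mono fun y hy => ((hs y hy).diag_pos i).le)
    have hmul : H t = X * Xᵀ := by
      have h1 : Tendsto (fun y => L y * (L y)ᵀ) F (𝓝 (X * Xᵀ)) :=
        ((continuous_id.matrix_mul continuous_id.matrix_transpose).tendsto X).comp hFX
      exact tendsto_nhds_unique_of_eventuallyEq (hH.mono_left hF) h1
        (hmem.mono fun y hy => (hs y hy).eq_mul)
    have hdet : X.det ≠ 0 := by
      intro h0
      have h1 : (H t).det = (X * Xᵀ).det := by rw [hmul]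
      rw [(hs t ht).eq_mul, Matrix.det_mul, Matrix.det_mul, h0, Matrix.det_transpose, zero_mul]
        at h1
      exact (mul_self_ne_zero.2 (hs t ht).isUnit_det.ne_zero) h1
    have hX' : X.IsLowerTriangular := fun i j h => hlow i j (OrderDual.toDual_lt_toDual.1 h)
    rw [Matrix.det_of_isLowerTriangular X hX', Finset.prod_ne_zero_iff] at hdet
    exact (hs t ht).unique
      ⟨hlow, fun i => lt_of_le_of_ne (hnonneg i) (hdet i (Finset.mem_univ i)).symm, hmul⟩

/-- Differentiating `L Lᵀ = H` along a segment: `L' = L * low (L⁻¹ K L⁻ᵀ)`. -/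
theorem IsCholesky.hasDerivWithinAt {n : ℕ} {H₀ K : Matrix (Fin n) (Fin n) ℝ}
    {L : ℝ → Matrix (Fin n) (Fin n) ℝ} {s : Set ℝ}
    (hs : ∀ t ∈ s, IsCholesky (H₀ + t • K) (L t)) {t : ℝ} (ht : t ∈ s) :
    HasDerivWithinAt L (L t * low ((L t)⁻¹ * K * ((L t)⁻¹)ᵀ)) s t := by
  have hc : ContinuousWithinAt L s t :=
    IsCholesky.continuousWithinAt hs ht (by fun_prop)
  rw [hasDerivWithinAt_iff_tendsto_slope]
  let M : ℝ → Matrix (Fin n) (Fin n) ℝ := fun y => (1 / 2 : ℝ) • (L t + L y)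
  have hM : Tendsto M (𝓝[s \ {t}] t) (𝓝 (L t)) := by
    have h1 : Tendsto M (𝓝[s] t) (𝓝 ((1 / 2 : ℝ) • (L t + L t))) :=
      (tendsto_const_nhds.add hc).const_smul _
    have h2 : (1 / 2 : ℝ) • (L t + L t) = L t := by module
    rw [h2] at h1
    exact h1.mono_left (nhdsWithin_mono _ Set.sdiff_subset)
  have hMi : Tendsto (fun y => (M y)⁻¹) (𝓝[s \ {t}] t) (𝓝 (L t)⁻¹) := by
    have hu := (hs t ht).isUnit_det
    have : ContinuousAt (Inv.inv : Matrix (Fin n) (Fin n) ℝ → _) (L t) := by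
      refine continuousAt_matrix_inv _ ?_
      rw [Ring.inverse_eq_inv']
      exact continuousAt_inv₀ hu.ne_zero
    exact this.tendsto.comp hM
  have hlim : Tendsto (fun y => M y * low ((M y)⁻¹ * K * ((M y)⁻¹)ᵀ)) (𝓝[s \ {t}] t)
      (𝓝 (L t * low ((L t)⁻¹ * K * ((L t)⁻¹)ᵀ))) := by
    have h3 : Tendsto (fun y => ((M y)⁻¹)ᵀ) (𝓝[s \ {t}] t) (𝓝 ((L t)⁻¹)ᵀ) :=
      (continuous_id.matrix_transpose.tendsto _).comp hMi
    exact hM.mul ((continuous_low.tendsto _).comp ((hMi.mul tendsto_const_nhds).mul h3))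
  refine hlim.congr' ?_
  filter_upwards [self_mem_nhdsWithin] with y hy
  have hyt : y - t ≠ 0 := sub_ne_zero.2 hy.2
  have hlow : ∀ (c : ℝ) (X : Matrix (Fin n) (Fin n) ℝ), low (c • X) = c • low X := by
    intro c X
    ext i j
    simp only [low, Matrix.of_apply, Matrix.smul_apply, smul_eq_mul]
    split_ifs <;> ring
  have hdiff : (H₀ + y • K) - (H₀ + t • K) = (y - t) • K := by module
  have hsub : L y - L t = M y * low ((M y)⁻¹ * ((y - t) • K) * ((M y)⁻¹)ᵀ) := by
    rw [← hdiff]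
    exact (hs t ht).sub_eq (hs y hy.1)
  rw [slope_def_module, hsub, Matrix.mul_smul (M y)⁻¹, Matrix.smul_mul (y - t), hlow,
    Matrix.mul_smul (M y), smul_smul, inv_mul_cancel₀ hyt, one_smul]

theorem exists_isCholesky {n : ℕ} {H : Matrix (Fin n) (Fin n) ℝ} (hH : H.PosDef) :
    ∃ L, IsCholesky H L := by
  let P := LDL.lower hH
  let d := LDL.diagEntries hH
  have hPinv : IsUnit (LDL.lowerInv hH).det :=
    (Matrix.isUnit_iff_isUnit_det _).1 (isUnit_of_invertible _)
  have hPl : ∀ i j, i < j → P i j = 0 :=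
    inv_apply_eq_zero_of_lower hPinv fun i j hij => LDL.lowerInv_triangular hH hij
  have hPH : P * Matrix.diagonal d * Pᵀ = H := by
    have := LDL.lower_conj_diag hH
    rwa [Matrix.conjTranspose_eq_transpose_of_trivial] at this
  have hdiag : Matrix.diagonal d = LDL.lowerInv hH * H * (LDL.lowerInv hH)ᴴ :=
    LDL.diag_eq_lowerInv_conj hH
  have hd : ∀ i, 0 < d i := by
    have : (Matrix.diagonal d).PosDef := by
      rw [hdiag]
      refine hH.mul_mul_conjTranspose_same ?_
      exact Matrix.vecMul_injective_of_isUnit (isUnit_of_invertible _)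
    exact Matrix.posDef_diagonal_iff.1 this
  have hPd : ∀ i, P i i ≠ 0 := by
    have hP' : P.IsLowerTriangular := fun i j h => hPl i j (OrderDual.toDual_lt_toDual.1 h)
    have hdet : P.det ≠ 0 := (Matrix.isUnit_nonsing_inv_det _ hPinv).ne_zero
    rw [Matrix.det_of_isLowerTriangular P hP', Finset.prod_ne_zero_iff] at hdet
    exact fun i => hdet i (Finset.mem_univ i)
  -- The signs make the diagonal of the factor positive.
  let e : Fin n → ℝ := fun i => SignType.sign (P i i) * √(d i)
  have he : ∀ i, e i * e i = d i := fun i => by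
    have h1 : (SignType.sign (P i i) : ℝ) * SignType.sign (P i i) = 1 := by
      rcases lt_or_gt_of_ne (hPd i) with h | h
      · simp [sign_neg h]
      · simp [sign_pos h]
    calc e i * e i = (SignType.sign (P i i) * SignType.sign (P i i)) * (√(d i) * √(d i)) := by
          simp only [e]; ring
      _ = d i := by rw [h1, one_mul, Real.mul_self_sqrt (hd i).le]
  refine ⟨P * Matrix.diagonal e, ?_, ?_, ?_⟩
  · intro i j hij
    rw [Matrix.mul_diagonal, hPl i j hij, zero_mul]
  · intro i
    have : 0 < P i i * SignType.sign (P i i) := by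
      rw [self_mul_sign]
      exact abs_pos.2 (hPd i)
    rw [Matrix.mul_diagonal, ← mul_assoc]
    exact mul_pos this (Real.sqrt_pos.2 (hd i))
  · rw [Matrix.transpose_mul, Matrix.diagonal_transpose, ← hPH, Matrix.mul_assoc, Matrix.mul_assoc,
      ← Matrix.mul_assoc (Matrix.diagonal e), Matrix.diagonal_mul_diagonal]
    simp only [he]

/-- Perturbation bound for the Cholesky factorization, without any smallness assumption: `α` and
`β` control the norms of the Cholesky factors and of the inverses along the segment from `H` to
`H + K`. -/
theorem IsCholesky.norm_sub_le {n : ℕ} (k : ℕ) (hk : n ≤ 2 ^ k)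
    {H K L L' : Matrix (Fin n) (Fin n) ℝ} (hL : IsCholesky H L) (hL' : IsCholesky (H + K) L')
    (hpos : ∀ t ∈ Set.Icc (0 : ℝ) 1, (H + t • K).PosDef) {α β : ℝ} (hα : 0 ≤ α)
    (hHα : ∀ t ∈ Set.Icc (0 : ℝ) 1, ‖H + t • K‖ ≤ α ^ 2)
    (hHβ : ∀ t ∈ Set.Icc (0 : ℝ) 1, ‖(H + t • K)⁻¹‖ ≤ β) :
    ‖L' - L‖ ≤ (1 / 2 + k) * α * β * ‖K‖ := by
  have hex : ∀ t : ℝ, ∃ X, t ∈ Set.Icc (0 : ℝ) 1 → IsCholesky (H + t • K) X := fun t => by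
    by_cases ht : t ∈ Set.Icc (0 : ℝ) 1
    · obtain ⟨X, hX⟩ := exists_isCholesky (hpos t ht)
      exact ⟨X, fun _ => hX⟩
    · exact ⟨0, fun h => absurd h ht⟩
  choose f hf using hex
  have h0 : f 0 = L := by
    have := hf 0 (by simp)
    rw [zero_smul, add_zero] at this
    exact hL.unique this
  have h1 : f 1 = L' := by
    have := hf 1 (by simp)
    rw [one_smul] at this
    exact hL'.unique this
  have hbound : ∀ t ∈ Set.Icc (0 : ℝ) 1, ‖f t * low ((f t)⁻¹ * K * ((f t)⁻¹)ᵀ)‖ ≤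
      (1 / 2 + k) * α * β * ‖K‖ := by
    intro t ht
    have hfα : ‖f t‖ ≤ α := by
      refine le_of_sq_le_sq ?_ hα
      rw [(hf t ht).norm_sq]
      exact hHα t ht
    have hfβ : ‖(f t)⁻¹‖ * ‖(f t)⁻¹‖ ≤ β := by
      refine le_trans (le_of_eq ?_) (hHβ t ht)
      rw [(hf t ht).eq_mul, Matrix.mul_inv_rev, ← Matrix.transpose_nonsing_inv,
        ← Matrix.l2_opNorm_conjTranspose_mul_self, Matrix.conjTranspose_eq_transpose_of_trivial]
    calc ‖f t * low ((f t)⁻¹ * K * ((f t)⁻¹)ᵀ)‖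
        ≤ ‖f t‖ * ‖low ((f t)⁻¹ * K * ((f t)⁻¹)ᵀ)‖ := Matrix.l2_opNorm_mul _ _
      _ ≤ ‖f t‖ * ((1 / 2 + k) * ‖(f t)⁻¹ * K * ((f t)⁻¹)ᵀ‖) := by
          gcongr
          exact norm_low_le k hk _
      _ ≤ ‖f t‖ * ((1 / 2 + k) * (‖(f t)⁻¹‖ * ‖K‖ * ‖((f t)⁻¹)ᵀ‖)) := by
          gcongr
          exact (Matrix.l2_opNorm_mul _ _).trans (by gcongr; exact Matrix.l2_opNorm_mul _ _)
      _ = ‖f t‖ * ((1 / 2 + k) * ((‖(f t)⁻¹‖ * ‖(f t)⁻¹‖) * ‖K‖)) := by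
          rw [norm_transpose]; ring
      _ ≤ α * ((1 / 2 + k) * (β * ‖K‖)) := by gcongr
      _ = _ := by ring
  have := Convex.norm_image_sub_le_of_norm_hasDerivWithin_le
    (fun t ht => IsCholesky.hasDerivWithinAt hf ht) hbound (convex_Icc (0 : ℝ) 1)
    (x := 0) (y := 1) (by simp) (by simp)
  rwa [h0, h1, sub_zero, norm_one, mul_one] at this

/-! ### Block matrices -/

theorem norm_one_matrix_le {n : ℕ} : ‖(1 : Matrix (Fin n) (Fin n) ℝ)‖ ≤ 1 := by
  rw [← Matrix.diagonal_one, Matrix.l2_opNorm_diagonal]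
  exact (pi_norm_le_iff_of_nonneg zero_le_one).2 fun i => by simp

theorem norm_le_one_of_transpose_mul_self {m n : ℕ} {M : Matrix (Fin m) (Fin n) ℝ}
    (hM : Mᵀ * M = 1) : ‖M‖ ≤ 1 := by
  have h := Matrix.l2_opNorm_conjTranspose_mul_self M
  rw [Matrix.conjTranspose_eq_transpose_of_trivial, hM] at h
  have h1 : ‖(1 : Matrix (Fin n) (Fin n) ℝ)‖ ≤ 1 := norm_one_matrix_le
  nlinarith [norm_nonneg M]

theorem glue_mul {m n : ℕ} (P P' : Matrix (Fin m) (Fin m) ℝ) (Q Q' : Matrix (Fin m) (Fin n) ℝ)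
    (R R' : Matrix (Fin n) (Fin m) ℝ) (S S' : Matrix (Fin n) (Fin n) ℝ) :
    glue P Q R S * glue P' Q' R' S' =
      glue (P * P' + Q * R') (P * Q' + Q * S') (R * P' + S * R') (R * Q' + S * S') := by
  simp only [glue, Matrix.reindex_apply]
  rw [Matrix.submatrix_mul_equiv, Matrix.fromBlocks_multiply]

theorem glue_transpose {m n : ℕ} (P : Matrix (Fin m) (Fin m) ℝ) (Q : Matrix (Fin m) (Fin n) ℝ)
    (R : Matrix (Fin n) (Fin m) ℝ) (S : Matrix (Fin n) (Fin n) ℝ) :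
    (glue P Q R S)ᵀ = glue Pᵀ Rᵀ Qᵀ Sᵀ := by
  simp only [glue, Matrix.transpose_reindex, Matrix.fromBlocks_transpose]

theorem glue_add {m n : ℕ} (P P' : Matrix (Fin m) (Fin m) ℝ) (Q Q' : Matrix (Fin m) (Fin n) ℝ)
    (R R' : Matrix (Fin n) (Fin m) ℝ) (S S' : Matrix (Fin n) (Fin n) ℝ) :
    glue P Q R S + glue P' Q' R' S' = glue (P + P') (Q + Q') (R + R') (S + S') := by
  simp only [glue, Matrix.reindex_apply, ← Matrix.fromBlocks_add]
  rfl

theorem glue_sub_glue {m n : ℕ} (P : Matrix (Fin m) (Fin m) ℝ) (Q : Matrix (Fin m) (Fin n) ℝ)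
    (R : Matrix (Fin n) (Fin m) ℝ) (S S' : Matrix (Fin n) (Fin n) ℝ) :
    glue P Q R S - glue P Q R S' = glue 0 0 0 (S - S') := by
  rw [sub_eq_iff_eq_add, glue_add, zero_add, zero_add, zero_add, sub_add_cancel]

theorem glue_zero {m n : ℕ} :
    (glue 0 0 0 0 : Matrix (Fin (m + n)) (Fin (m + n)) ℝ) = 0 := by
  simp [glue]

theorem block22_glue {m n : ℕ} (P : Matrix (Fin m) (Fin m) ℝ) (Q : Matrix (Fin m) (Fin n) ℝ)
    (R : Matrix (Fin n) (Fin m) ℝ) (S : Matrix (Fin n) (Fin n) ℝ) :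
    block22 (glue P Q R S) = S := by
  ext i j
  simp [block22, glue]

theorem eq_glue {m n : ℕ} {A : Matrix (Fin (m + n)) (Fin (m + n)) ℝ} (hA : Aᵀ = A) :
    A = glue (block11 A) (block12 A) (block12 A)ᵀ (block22 A) := by
  ext i j
  refine Fin.addCases (fun i => ?_) (fun i => ?_) i <;>
    refine Fin.addCases (fun j => ?_) (fun j => ?_) j <;>
    simp [glue, block11, block12, block22]
  rw [← Matrix.transpose_apply A, hA]

/-- The inclusion of the last `n` coordinates as a matrix with orthonormal columns. -/
noncomputable def tailIncl (m n : ℕ) : Matrix (Fin (m + n)) (Fin n) ℝ :=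
  Matrix.of fun i j => if i = Fin.natAdd m j then 1 else 0

theorem block22_eq {m n : ℕ} (A : Matrix (Fin (m + n)) (Fin (m + n)) ℝ) :
    block22 A = (tailIncl m n)ᵀ * A * tailIncl m n := by
  ext i j
  simp [Matrix.mul_apply, tailIncl, block22]

theorem tailIncl_transpose_mul_self {m n : ℕ} : (tailIncl m n)ᵀ * tailIncl m n = 1 := by
  ext i j
  simp [Matrix.mul_apply, tailIncl, Matrix.one_apply, eq_comm]

theorem glue_zero_eq {m n : ℕ} (S : Matrix (Fin n) (Fin n) ℝ) :
    (glue 0 0 0 S : Matrix (Fin (m + n)) (Fin (m + n)) ℝ) =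
      tailIncl m n * S * (tailIncl m n)ᵀ := by
  have hne : ∀ (i : Fin m) (k : Fin n), Fin.castAdd n i ≠ Fin.natAdd m k := fun i k h => by
    have := congrArg Fin.val h
    simp only [Fin.val_castAdd, Fin.val_natAdd] at this
    omega
  ext i j
  refine Fin.addCases (fun i => ?_) (fun i => ?_) i <;>
    refine Fin.addCases (fun j => ?_) (fun j => ?_) j <;>
    simp [Matrix.mul_apply, tailIncl, glue, hne]

theorem norm_tailIncl_le {m n : ℕ} : ‖tailIncl m n‖ ≤ 1 :=
  norm_le_one_of_transpose_mul_self tailIncl_transpose_mul_self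

theorem norm_block22_le {m n : ℕ} (A : Matrix (Fin (m + n)) (Fin (m + n)) ℝ) :
    ‖block22 A‖ ≤ ‖A‖ := by
  have hJ : ‖tailIncl m n‖ ≤ 1 := norm_tailIncl_le
  rw [block22_eq]
  calc _ ≤ ‖(tailIncl m n)ᵀ‖ * ‖A‖ * ‖tailIncl m n‖ :=
        (Matrix.l2_opNorm_mul _ _).trans (by gcongr; exact Matrix.l2_opNorm_mul _ _)
    _ ≤ 1 * ‖A‖ * 1 := by rw [norm_transpose]; gcongr
    _ = ‖A‖ := by ring

theorem norm_glue_zero_le {m n : ℕ} (S : Matrix (Fin n) (Fin n) ℝ) :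
    ‖(glue 0 0 0 S : Matrix (Fin (m + n)) (Fin (m + n)) ℝ)‖ ≤ ‖S‖ := by
  have hJ : ‖tailIncl m n‖ ≤ 1 := norm_tailIncl_le
  rw [glue_zero_eq]
  calc _ ≤ ‖tailIncl m n‖ * ‖S‖ * ‖(tailIncl m n)ᵀ‖ :=
        (Matrix.l2_opNorm_mul _ _).trans (by gcongr; exact Matrix.l2_opNorm_mul _ _)
    _ ≤ 1 * ‖S‖ * 1 := by rw [norm_transpose]; gcongr
    _ = ‖S‖ := by ring

theorem glue_zero_posSemidef {m n : ℕ} {S : Matrix (Fin n) (Fin n) ℝ} (hS : S.PosSemidef) :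
    (glue 0 0 0 S : Matrix (Fin (m + n)) (Fin (m + n)) ℝ).PosSemidef := by
  rw [glue_zero_eq]
  have := hS.mul_mul_conjTranspose_same (tailIncl m n)
  rwa [Matrix.conjTranspose_eq_transpose_of_trivial] at this

theorem factor_eq {m n : ℕ} (L₁ : Matrix (Fin m) (Fin m) ℝ) (L₂ : Matrix (Fin n) (Fin n) ℝ)
    (C : Matrix (Fin m) (Fin n) ℝ) (D : Matrix (Fin n) (Fin n) ℝ) :
    factor L₁ L₂ C D = glue L₁ 0 (L₂ * Cᵀ) (L₂ * D) := by
  simp [factor, glue_mul]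

theorem factor_lower {m n : ℕ} {L₁ : Matrix (Fin m) (Fin m) ℝ} {L₂ D : Matrix (Fin n) (Fin n) ℝ}
    (C : Matrix (Fin m) (Fin n) ℝ) (h₁ : ∀ i j, i < j → L₁ i j = 0)
    (h₂ : ∀ i j, i < j → L₂ i j = 0) (hD : ∀ i j, i < j → D i j = 0) (i j : Fin (m + n))
    (hij : i < j) : factor L₁ L₂ C D i j = 0 := by
  rw [factor_eq]
  induction i using Fin.addCases with
  | left i =>
    induction j using Fin.addCases with
    | left j => simpa [glue] using h₁ i j hij
    | right j => simp [glue]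
  | right i =>
    induction j using Fin.addCases with
    | left j => simp only [Fin.lt_def, Fin.val_natAdd, Fin.val_castAdd] at hij; omega
    | right j =>
      simpa [glue] using mul_apply_eq_zero_of_lower h₂ hD i j (by simpa using hij)

theorem lower_mul_apply_self {n : ℕ} {M N : Matrix (Fin n) (Fin n) ℝ}
    (hM : ∀ i j, i < j → M i j = 0) (hN : ∀ i j, i < j → N i j = 0) (i : Fin n) :
    (M * N) i i = M i i * N i i := by
  rw [Matrix.mul_apply, Finset.sum_eq_single i]
  · intro j _ hji
    rcases lt_or_gt_of_ne hji with h | h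
    · rw [hN j i h, mul_zero]
    · rw [hM i j h, zero_mul]
  · simp

theorem factor_diag_pos {m n : ℕ} {L₁ : Matrix (Fin m) (Fin m) ℝ}
    {L₂ D : Matrix (Fin n) (Fin n) ℝ} (C : Matrix (Fin m) (Fin n) ℝ) (h₁ : ∀ i, 0 < L₁ i i)
    (h₂ : ∀ i j, i < j → L₂ i j = 0) (h₂' : ∀ i, 0 < L₂ i i) (hD : ∀ i j, i < j → D i j = 0)
    (hD' : ∀ i, 0 < D i i) (i : Fin (m + n)) : 0 < factor L₁ L₂ C D i i := by
  rw [factor_eq]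
  induction i using Fin.addCases with
  | left i => simpa [glue] using h₁ i
  | right i =>
    have := mul_pos (h₂' i) (hD' i)
    rw [← lower_mul_apply_self h₂ hD] at this
    simpa [glue] using this

theorem factor_sub_factor {m n : ℕ} (L₁ : Matrix (Fin m) (Fin m) ℝ)
    (L₂ : Matrix (Fin n) (Fin n) ℝ) (C : Matrix (Fin m) (Fin n) ℝ)
    (D D' : Matrix (Fin n) (Fin n) ℝ) :
    factor L₁ L₂ C D - factor L₁ L₂ C D' = glue 0 0 0 (L₂ * (D - D')) := by
  rw [factor_eq, factor_eq, glue_sub_glue, Matrix.mul_sub]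

/-- Replacing the Schur complement `1 - Cᵀ * C` by `W` in the block factorization of `A` changes
only the trailing block. -/
theorem factor_mul_transpose {m n : ℕ} {A : Matrix (Fin (m + n)) (Fin (m + n)) ℝ} (hA : Aᵀ = A)
    {L₁ : Matrix (Fin m) (Fin m) ℝ} (hL₁ : IsCholesky (block11 A) L₁)
    {L₂ : Matrix (Fin n) (Fin n) ℝ} (hL₂ : IsCholesky (block22 A) L₂)
    {C : Matrix (Fin m) (Fin n) ℝ} (hC : C = scaledBlock A L₁ L₂)
    {D W : Matrix (Fin n) (Fin n) ℝ} (hD : D * Dᵀ = W) :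
    factor L₁ L₂ C D * (factor L₁ L₂ C D)ᵀ =
      A + glue 0 0 0 (L₂ * (W - (1 - Cᵀ * C)) * L₂ᵀ) := by
  have h12 : block12 A = L₁ * C * L₂ᵀ := by
    have h2 : (L₂⁻¹)ᵀ * L₂ᵀ = 1 := by
      rw [← Matrix.transpose_mul, Matrix.mul_nonsing_inv _ hL₂.isUnit_det, Matrix.transpose_one]
    rw [hC, scaledBlock, ← Matrix.mul_assoc, ← Matrix.mul_assoc,
      Matrix.mul_nonsing_inv _ hL₁.isUnit_det, Matrix.one_mul, Matrix.mul_assoc, h2, Matrix.mul_one]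
  conv_rhs => rw [eq_glue hA]
  rw [glue_add, factor_eq, glue_transpose, glue_mul, hL₁.eq_mul, hL₂.eq_mul, h12, ← hD]
  simp only [Matrix.transpose_mul, Matrix.transpose_transpose, Matrix.transpose_zero,
    Matrix.mul_zero, Matrix.zero_mul, add_zero, Matrix.mul_assoc]
  congr 1
  simp only [Matrix.sub_mul, Matrix.mul_sub, Matrix.one_mul, Matrix.mul_assoc]
  abel

/-! ### Matrices diagonalized by a fixed orthogonal matrix -/

/-- The symmetric matrix `V * diagonal d * Vᵀ`; for orthogonal `V` its eigenvalues are the `d j`. -/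
noncomputable def conjDiag {n : ℕ} (V : Matrix (Fin n) (Fin n) ℝ) (d : Fin n → ℝ) :
    Matrix (Fin n) (Fin n) ℝ :=
  V * Matrix.diagonal d * Vᵀ

section conjDiag

variable {n : ℕ} {V : Matrix (Fin n) (Fin n) ℝ}

theorem conjDiag_add (d e : Fin n → ℝ) : conjDiag V d + conjDiag V e = conjDiag V (d + e) := by
  rw [conjDiag, conjDiag, conjDiag, ← Matrix.add_mul, ← Matrix.mul_add, Matrix.diagonal_add]
  rfl

theorem conjDiag_smul (c : ℝ) (d : Fin n → ℝ) : c • conjDiag V d = conjDiag V (c • d) := by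
  rw [conjDiag, conjDiag, Matrix.diagonal_smul, Matrix.mul_smul, Matrix.smul_mul]

theorem conjDiag_sub (d e : Fin n → ℝ) : conjDiag V d - conjDiag V e = conjDiag V (d - e) := by
  rw [sub_eq_iff_eq_add, conjDiag_add, sub_add_cancel]

theorem conjDiag_one (hV : V * Vᵀ = 1) : conjDiag V 1 = 1 := by
  rw [conjDiag, ← hV]
  congr 1
  exact (congrArg (V * ·) Matrix.diagonal_one).trans (Matrix.mul_one V)

theorem conjDiag_mul (hV : Vᵀ * V = 1) (d e : Fin n → ℝ) :
    conjDiag V d * conjDiag V e = conjDiag V (d * e) := by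
  calc conjDiag V d * conjDiag V e
      = V * Matrix.diagonal d * (Vᵀ * V) * Matrix.diagonal e * Vᵀ := by
        simp only [conjDiag, Matrix.mul_assoc]
    _ = conjDiag V (d * e) := by
        rw [hV, Matrix.mul_one, Matrix.mul_assoc V, Matrix.diagonal_mul_diagonal]
        rfl

theorem conjDiag_inv (hV : V * Vᵀ = 1) (hV' : Vᵀ * V = 1) {d : Fin n → ℝ} (hd : ∀ i, d i ≠ 0) :
    (conjDiag V d)⁻¹ = conjDiag V d⁻¹ := by
  refine Matrix.inv_eq_right_inv ?_
  have h : d * d⁻¹ = 1 := funext fun i => mul_inv_cancel₀ (hd i)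
  rw [conjDiag_mul hV', h, conjDiag_one hV]

theorem conjDiag_posSemidef {d : Fin n → ℝ} (hd : ∀ i, 0 ≤ d i) : (conjDiag V d).PosSemidef := by
  have := (Matrix.posSemidef_diagonal_iff.2 hd).mul_mul_conjTranspose_same V
  rwa [Matrix.conjTranspose_eq_transpose_of_trivial] at this

theorem conjDiag_posDef_iff (hV : V * Vᵀ = 1) {d : Fin n → ℝ} :
    (conjDiag V d).PosDef ↔ ∀ i, 0 < d i := by
  have hu : IsUnit V := (Matrix.isUnit_iff_isUnit_det V).2 (Matrix.isUnit_det_of_right_inverse hV)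
  have h := Matrix.IsUnit.posDef_star_right_conjugate_iff (x := Matrix.diagonal d) hu
  rw [Matrix.star_eq_conjTranspose, Matrix.conjTranspose_eq_transpose_of_trivial,
    Matrix.posDef_diagonal_iff] at h
  exact h

theorem norm_conjDiag_le (hV : Vᵀ * V = 1) {d : Fin n → ℝ} {c : ℝ} (hc : 0 ≤ c)
    (hd : ∀ i, |d i| ≤ c) : ‖conjDiag V d‖ ≤ c := by
  have hV1 := norm_le_one_of_transpose_mul_self hV
  have hD : ‖(Matrix.diagonal d : Matrix (Fin n) (Fin n) ℝ)‖ ≤ c := by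
    rw [Matrix.l2_opNorm_diagonal]
    exact (pi_norm_le_iff_of_nonneg hc).2 hd
  calc ‖conjDiag V d‖ ≤ ‖V‖ * ‖(Matrix.diagonal d : Matrix (Fin n) (Fin n) ℝ)‖ * ‖Vᵀ‖ :=
        (Matrix.l2_opNorm_mul _ _).trans (by gcongr; exact Matrix.l2_opNorm_mul _ _)
    _ ≤ 1 * c * 1 := by rw [norm_transpose]; gcongr
    _ = c := by ring

theorem sqrt_conjDiag (hV : Vᵀ * V = 1) {d : Fin n → ℝ} (hd : ∀ i, 0 ≤ d i) :
    CFC.sqrt (conjDiag V d) = conjDiag V fun i => √(d i) := by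
  refine CFC.sqrt_unique ?_ (conjDiag_posSemidef fun i => Real.sqrt_nonneg _).nonneg
  rw [conjDiag_mul hV]
  congr 1
  exact funext fun i => Real.mul_self_sqrt (hd i)

theorem conjDiag_transpose (d : Fin n → ℝ) : (conjDiag V d)ᵀ = conjDiag V d := by
  simp [conjDiag, Matrix.mul_assoc]

end conjDiag

/-! ### The matrices `I - V Σᵀ Σ Vᵀ` and `I - V₁ Σ₁² V₁ᵀ` -/

theorem sv_eq_zero_of_le {m n : ℕ} (C : Matrix (Fin m) (Fin n) ℝ) {i : ℕ} (hi : m ≤ i) :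
    sv C i = 0 := by
  rw [sv, LinearMap.singularValues_eq_zero_iff_le_finrank_range]
  exact (Submodule.finrank_le _).trans (by rwa [finrank_euclideanSpace_fin])

theorem rectDiag_transpose_mul_self {m n : ℕ} {s : ℕ → ℝ} (hs : ∀ i, m ≤ i → s i = 0) :
    (rectDiag m n s)ᵀ * rectDiag m n s = Matrix.diagonal fun j : Fin n => s j ^ 2 := by
  ext j k
  rw [Matrix.mul_apply, Matrix.diagonal_apply]
  simp only [Matrix.transpose_apply, rectDiag, Matrix.of_apply]
  by_cases hj : (j : ℕ) < m
  · rw [Finset.sum_eq_single ⟨j, hj⟩]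
    · by_cases hjk : j = k
      · simp [hjk, sq]
      · have : (j : ℕ) ≠ k := fun h => hjk (Fin.ext h)
        simp [hjk, this]
    · intro i _ hi
      have : (i : ℕ) ≠ j := fun h => hi (Fin.ext h)
      simp [this]
    · simp
  · rw [hs j (not_lt.1 hj), Finset.sum_eq_zero]
    · simp
    · intro i _
      rw [if_neg (by omega), zero_mul]

theorem fullGram_eq {m n : ℕ} (C : Matrix (Fin m) (Fin n) ℝ) {V : Matrix (Fin n) (Fin n) ℝ}
    (hV : V * Vᵀ = 1) : fullGram C V = conjDiag V fun j => 1 - sv C j ^ 2 := by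
  rw [fullGram, Matrix.mul_assoc V, rectDiag_transpose_mul_self fun i => sv_eq_zero_of_le C]
  nth_rewrite 1 [← conjDiag_one hV]
  exact conjDiag_sub _ _

theorem truncGram_eq {m n r : ℕ} (C : Matrix (Fin m) (Fin n) ℝ) {V : Matrix (Fin n) (Fin n) ℝ}
    (hV : V * Vᵀ = 1) (hr : r ≤ n) :
    truncGram C V hr = conjDiag V fun j => 1 - if (j : ℕ) < r then sv C j ^ 2 else 0 := by
  obtain ⟨q, rfl⟩ := Nat.exists_eq_add_of_le hr
  have h : V.submatrix id (Fin.castLE hr) * (Matrix.diagonal fun i : Fin r => sv C i) ^ 2 *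
      (V.submatrix id (Fin.castLE hr))ᵀ =
        conjDiag V fun j => if (j : ℕ) < r then sv C j ^ 2 else 0 := by
    ext i k
    rw [conjDiag, Matrix.diagonal_pow, Matrix.mul_apply, Matrix.mul_apply, Fin.sum_univ_add]
    simp [Matrix.mul_diagonal]
    rfl
  rw [truncGram, h]
  nth_rewrite 1 [← conjDiag_one hV]
  exact conjDiag_sub _ _

theorem fullGram_eq_one_sub {m n : ℕ} {C : Matrix (Fin m) (Fin n) ℝ}
    {U : Matrix (Fin m) (Fin m) ℝ} {V : Matrix (Fin n) (Fin n) ℝ} (h : IsSVD C U V) :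
    fullGram C V = 1 - Cᵀ * C := by
  have hU : Uᵀ * U = 1 := (Matrix.mem_orthogonalGroup_iff' (Fin m) ℝ).1 h.left_orthogonal
  have : Cᵀ * C = V * (rectDiag m n (sv C))ᵀ * rectDiag m n (sv C) * Vᵀ := by
    calc Cᵀ * C = (U * rectDiag m n (sv C) * Vᵀ)ᵀ * (U * rectDiag m n (sv C) * Vᵀ) := by
          rw [← h.eq_mul]
      _ = V * (rectDiag m n (sv C))ᵀ * (Uᵀ * U) * rectDiag m n (sv C) * Vᵀ := by
          simp only [Matrix.transpose_mul, Matrix.transpose_transpose, Matrix.mul_assoc]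
      _ = _ := by rw [hU, Matrix.mul_one]
  rw [this, fullGram]

/-- The Schur complement of a positive definite matrix, after scaling by the Cholesky factors of
its diagonal blocks, is positive definite. -/
theorem one_sub_posDef {m n : ℕ} {A : Matrix (Fin (m + n)) (Fin (m + n)) ℝ} (hA : A.PosDef)
    {L₁ : Matrix (Fin m) (Fin m) ℝ} (hL₁ : IsCholesky (block11 A) L₁)
    {L₂ : Matrix (Fin n) (Fin n) ℝ} (hL₂ : IsCholesky (block22 A) L₂)
    {C : Matrix (Fin m) (Fin n) ℝ} (hC : C = scaledBlock A L₁ L₂) :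
    (1 - Cᵀ * C).PosDef := by
  have hAt : Aᵀ = A := by
    rw [← Matrix.conjTranspose_eq_transpose_of_trivial]; exact hA.isHermitian
  have hone : ∀ i j : Fin n, i < j → (1 : Matrix (Fin n) (Fin n) ℝ) i j = 0 :=
    fun i j h => Matrix.one_apply_ne h.ne
  set F := factor L₁ L₂ C 1 with hF
  have hu : IsUnit F := (Matrix.isUnit_iff_isUnit_det F).2 <| isUnit_det_of_lower
    (factor_lower C hL₁.lower hL₂.lower hone)
    (factor_diag_pos C hL₁.diag_pos hL₂.lower hL₂.diag_pos hone fun i => by simp)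
  have hAF : A = F * glue 1 0 0 (1 - Cᵀ * C) * star F := by
    have h := factor_mul_transpose hAt hL₁ hL₂ hC (D := 1) (W := 1) (by simp)
    rw [← hF] at h
    have h1 : F * glue 1 0 0 (1 - Cᵀ * C) * Fᵀ =
        F * Fᵀ - F * glue 0 0 0 (Cᵀ * C) * Fᵀ := by
      have : glue 1 0 0 (1 - Cᵀ * C) = 1 - glue (m := m) 0 0 0 (Cᵀ * C) := by
        have h11 : (1 : Matrix (Fin (m + n)) (Fin (m + n)) ℝ) = glue 1 0 0 1 := by
          simp [glue]
        rw [eq_sub_iff_add_eq, glue_add, h11]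
        simp
      rw [this, Matrix.mul_sub, Matrix.sub_mul, Matrix.mul_one]
    rw [Matrix.star_eq_conjTranspose, Matrix.conjTranspose_eq_transpose_of_trivial, h1, h, hF,
      factor_eq, glue_transpose, glue_mul, glue_mul]
    simp
  rw [hAF, Matrix.IsUnit.posDef_star_right_conjugate_iff hu] at hA
  rw [← block22_glue 1 0 0 (1 - Cᵀ * C)]
  exact hA.submatrix (Fin.natAdd_injective n m)

/-- The factor `√(1 - s (n - 1) ^ 2)` is the norm of `D`, whereas
`IsCholesky.norm_sub_le` needs a bound along the whole segment, and there only the bound `1` is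
uniform. The two differ by at most the factor `2` as long as `1 / 4 ≤ 1 - s (n - 1) ^ 2`; otherwise
the right-hand side exceeds `‖D'‖ + ‖D‖`. -/
theorem norm_cholesky_trunc_sub_le {n : ℕ} (hn : 0 < n) {V : Matrix (Fin n) (Fin n) ℝ}
    (hV : V * Vᵀ = 1) (hV' : Vᵀ * V = 1) {s : ℕ → ℝ} (hs : Antitone s) (h0 : ∀ i, 0 ≤ s i)
    (h1 : s 0 < 1) {r : ℕ} {D D' : Matrix (Fin n) (Fin n) ℝ}
    (hD : IsCholesky (conjDiag V fun j => 1 - s j ^ 2) D)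
    (hD' : IsCholesky (conjDiag V fun j => 1 - if (j : ℕ) < r then s j ^ 2 else 0) D') :
    ‖D' - D‖ ≤ (1 + 2 * (⌈Real.logb 2 n⌉₊ : ℝ)) * √(1 - s (n - 1) ^ 2) / (1 - s 0 ^ 2) *
      s r ^ 2 := by
  set k := ⌈Real.logb 2 n⌉₊ with hk
  have hnk : n ≤ 2 ^ k := by
    have h2 : Real.logb 2 n ≤ k := Nat.le_ceil _
    rw [Real.logb_le_iff_le_rpow one_lt_two (by exact_mod_cast hn), Real.rpow_natCast] at h2
    exact_mod_cast h2
  have hle0 : ∀ i, s i ^ 2 ≤ s 0 ^ 2 := fun i => pow_le_pow_left₀ (h0 i) (hs (Nat.zero_le i)) 2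
  have hb : 0 < 1 - s 0 ^ 2 := by nlinarith [h0 0]
  have hba : 1 - s 0 ^ 2 ≤ 1 - s (n - 1) ^ 2 := by linarith [hle0 (n - 1)]
  rcases le_or_gt n r with hnr | hrn
  -- No singular value is dropped when `n ≤ r`, so the two factors agree.
  · have : (fun j : Fin n => 1 - if (j : ℕ) < r then s j ^ 2 else 0) =
        fun j : Fin n => 1 - s j ^ 2 :=
      funext fun j => by rw [if_pos (by omega)]
    rw [this] at hD'
    rw [hD.unique hD', sub_self, norm_zero]
    positivity
  let e : Fin n → ℝ := fun j => if (j : ℕ) < r then 0 else s j ^ 2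
  have he0 : ∀ j, 0 ≤ e j := fun j => by simp only [e]; split_ifs <;> positivity
  have her : ∀ j, e j ≤ s r ^ 2 := fun j => by
    simp only [e]
    split_ifs with h
    · positivity
    · exact pow_le_pow_left₀ (h0 j) (hs (not_lt.1 h)) 2
  have hes : ∀ j, e j ≤ s j ^ 2 := fun j => by
    simp only [e]
    split_ifs
    · positivity
    · exact le_rfl
  have hsum : conjDiag V (fun j => 1 - if (j : ℕ) < r then s j ^ 2 else 0) =
      conjDiag V (fun j => 1 - s j ^ 2) + conjDiag V e := by
    rw [conjDiag_add]
    congr 1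
    ext j
    simp only [e, Pi.add_apply]
    split_ifs <;> ring
  by_cases ha : 1 / 4 ≤ 1 - s (n - 1) ^ 2
  · have hseg : ∀ t : ℝ, conjDiag V (fun j => 1 - s j ^ 2) + t • conjDiag V e =
        conjDiag V fun j => 1 - s j ^ 2 + t * e j := fun t => by
      rw [conjDiag_smul, conjDiag_add]
      rfl
    have hlow : ∀ t ∈ Set.Icc (0 : ℝ) 1, ∀ j : Fin n,
        1 - s 0 ^ 2 ≤ 1 - s j ^ 2 + t * e j :=
      fun t ht j => by nlinarith [hle0 j, mul_nonneg ht.1 (he0 j)]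
    have hup : ∀ t ∈ Set.Icc (0 : ℝ) 1, ∀ j : Fin n, 1 - s j ^ 2 + t * e j ≤ 1 := fun t ht j => by
      nlinarith [hes j, mul_le_mul_of_nonneg_right ht.2 (he0 j)]
    have hmain := hD.norm_sub_le k hnk (hsum ▸ hD') (α := 1) (β := (1 - s 0 ^ 2)⁻¹)
      (fun t ht => by
        rw [hseg, conjDiag_posDef_iff hV]
        exact fun j => hb.trans_le (hlow t ht j)) zero_le_one
      (fun t ht => by
        rw [hseg, one_pow]
        refine norm_conjDiag_le hV' zero_le_one fun j => ?_
        rw [abs_of_pos (hb.trans_le (hlow t ht j))]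
        exact hup t ht j)
      (fun t ht => by
        rw [hseg, conjDiag_inv hV hV' fun j => (hb.trans_le (hlow t ht j)).ne']
        refine norm_conjDiag_le hV' (inv_nonneg.2 hb.le) fun j => ?_
        rw [Pi.inv_apply, abs_of_pos (inv_pos.2 (hb.trans_le (hlow t ht j)))]
        exact inv_anti₀ hb (hlow t ht j))
    have hK : ‖conjDiag V e‖ ≤ s r ^ 2 := norm_conjDiag_le hV' (by positivity) fun j => by
      rw [abs_of_nonneg (he0 j)]
      exact her j
    have hsq : (1 / 2 : ℝ) ≤ √(1 - s (n - 1) ^ 2) := Real.le_sqrt_of_sq_le (by linarith)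
    calc ‖D' - D‖ ≤ (1 / 2 + k) * 1 * (1 - s 0 ^ 2)⁻¹ * ‖conjDiag V e‖ := hmain
      _ ≤ (1 / 2 + k) * 1 * (1 - s 0 ^ 2)⁻¹ * s r ^ 2 := by gcongr
      _ = (1 + 2 * k) * (1 / 2) / (1 - s 0 ^ 2) * s r ^ 2 := by field_simp
      _ ≤ _ := by gcongr
  · rw [not_le] at ha
    set a := 1 - s (n - 1) ^ 2 with hadef
    have hapos : 0 < a := hb.trans_le hba
    have hsr : 3 / 4 ≤ s r ^ 2 := by
      have := pow_le_pow_left₀ (h0 (n - 1)) (hs (show r ≤ n - 1 by omega)) 2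
      linarith
    have hsq : √a ≤ 1 / 2 := Real.sqrt_le_iff.2 ⟨by norm_num, by linarith⟩
    have hnD : ‖D‖ ≤ 1 / 2 := by
      refine le_trans (Real.le_sqrt_of_sq_le ?_) hsq
      rw [hD.norm_sq]
      refine norm_conjDiag_le hV' hapos.le fun j => ?_
      have h2 := hle0 j
      have h3 := pow_le_pow_left₀ (h0 (n - 1)) (hs (show (j : ℕ) ≤ n - 1 by omega)) 2
      rw [abs_of_pos (by linarith)]
      linarith
    have hnD' : ‖D'‖ ≤ 1 := by
      refine le_of_sq_le_sq ?_ zero_le_one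
      rw [hD'.norm_sq, one_pow]
      refine norm_conjDiag_le hV' zero_le_one fun j => ?_
      have h2 := hle0 j
      have h3 := sq_nonneg (s j)
      split_ifs
      · rw [abs_of_pos (by linarith)]
        linarith
      · simp
    have hdiv : 2 ≤ √a / (1 - s 0 ^ 2) := by
      rw [le_div_iff₀ hb]
      have := Real.sq_sqrt hapos.le
      nlinarith [Real.sqrt_nonneg a]
    calc ‖D' - D‖ ≤ ‖D'‖ + ‖D‖ := norm_sub_le _ _
      _ ≤ 1 * 2 * (3 / 4) := by linarith
      _ ≤ (1 + 2 * k) * (√a / (1 - s 0 ^ 2)) * s r ^ 2 := by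
          gcongr
          have : (0 : ℝ) ≤ k := Nat.cast_nonneg k
          linarith
      _ = _ := by ring

end ESIF

/-! ### The truncated factors and the preconditioner -/

/-- Matrix norms are spectral norms (the norm induced by the Euclidean norm); the index of `σ`
starts at `0`, so `σ 0`, `σ r` are the first and the `(r + 1)`-st singular value of `C`. -/
theorem theorem1 {m n : ℕ} (hm : 0 < m) (hn : 0 < n)
    (A : Matrix (Fin (m + n)) (Fin (m + n)) ℝ) (hA : A.PosDef)
    (L₁ : Matrix (Fin m) (Fin m) ℝ) (hL₁ : ESIF.IsCholesky (ESIF.block11 A) L₁)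
    (L₂ : Matrix (Fin n) (Fin n) ℝ) (hL₂ : ESIF.IsCholesky (ESIF.block22 A) L₂)
    (C : Matrix (Fin m) (Fin n) ℝ) (hC : C = ESIF.scaledBlock A L₁ L₂)
    (σ : ℕ → ℝ) (hσ : σ = ESIF.sv C)
    (U : Matrix (Fin m) (Fin m) ℝ) (V : Matrix (Fin n) (Fin n) ℝ) (hUV : ESIF.IsSVD C U V)
    (r : ℕ) (hr : r ≤ min m n)
    (τ : ℝ) (hτr : 0 < r → τ ≤ σ (r - 1)) (hτ : σ r ≤ τ) :
    -- the matrix `I - V₁ Σ₁² V₁ᵀ`, whose Cholesky factor and square root are used below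
    (ESIF.truncGram C V (hr.trans (min_le_right m n))).PosDef ∧
    -- the eSIF factor and preconditioner built with the Cholesky factor
    (∀ D : Matrix (Fin n) (Fin n) ℝ,
      ESIF.IsCholesky (ESIF.truncGram C V (hr.trans (min_le_right m n))) D →
      ∀ Lt At : Matrix (Fin (m + n)) (Fin (m + n)) ℝ,
        Lt = ESIF.factor L₁ L₂ C D → At = Lt * Ltᵀ →
        (∃ E : Matrix (Fin (m + n)) (Fin (m + n)) ℝ,
          At = A + E ∧ E.PosSemidef ∧ ‖E‖ / ‖A‖ ≤ σ r ^ 2 ∧ σ r ^ 2 ≤ τ ^ 2) ∧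
        ∀ L : Matrix (Fin (m + n)) (Fin (m + n)) ℝ, ESIF.IsCholesky A L →
          ‖Lt - L‖ / ‖L‖ ≤
            (1 + 2 * (⌈Real.logb 2 n⌉₊ : ℝ)) *
              √(1 - (if n ≤ m then σ (n - 1) else 0) ^ 2) / (1 - σ 0 ^ 2) * τ ^ 2) ∧
    -- the factors built with positive semidefinite square roots
    (∀ Lt L : Matrix (Fin (m + n)) (Fin (m + n)) ℝ,
      Lt = ESIF.factor L₁ L₂ C
        (CFC.sqrt (ESIF.truncGram C V (hr.trans (min_le_right m n)))) →
      L = ESIF.glue L₁ 0 (L₂ * Cᵀ) (L₂ * CFC.sqrt (ESIF.fullGram C V)) →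
      A = L * Lᵀ ∧ (0 < τ → ‖Lt - L‖ / ‖L‖ < τ ^ 2)) := by
  open ESIF in
  have hV : V * Vᵀ = 1 := (Matrix.mem_orthogonalGroup_iff (Fin n) ℝ).1 hUV.right_orthogonal
  have hV' : Vᵀ * V = 1 := (Matrix.mem_orthogonalGroup_iff' (Fin n) ℝ).1 hUV.right_orthogonal
  have hAt : Aᵀ = A := by
    rw [← Matrix.conjTranspose_eq_transpose_of_trivial]; exact hA.isHermitian
  have hanti : Antitone σ := by
    rw [hσ]; exact (Matrix.toEuclideanLin C).singularValues_antitone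
  have hnn : ∀ i, 0 ≤ σ i := by
    rw [hσ]; exact (Matrix.toEuclideanLin C).singularValues_nonneg
  have hfull : fullGram C V = conjDiag V fun j => 1 - σ j ^ 2 := by
    rw [hσ]; exact fullGram_eq C hV
  have htrunc : truncGram C V (hr.trans (min_le_right m n)) =
      conjDiag V fun j => 1 - if (j : ℕ) < r then σ j ^ 2 else 0 := by
    rw [hσ]; exact truncGram_eq C hV _
  have hschur : (fullGram C V).PosDef := by
    rw [fullGram_eq_one_sub hUV]; exact one_sub_posDef hA hL₁ hL₂ hC
  have hdpos : ∀ j : Fin n, 0 < 1 - σ j ^ 2 := by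
    rwa [hfull, conjDiag_posDef_iff hV] at hschur
  have hσ0 : σ 0 < 1 := by
    have := hdpos ⟨0, hn⟩
    nlinarith [hnn 0]
  have hd'pos : ∀ j : Fin n, 0 < 1 - if (j : ℕ) < r then σ j ^ 2 else 0 := fun j => by
    split_ifs
    · exact hdpos j
    · norm_num
  have hsqτ : σ r ^ 2 ≤ τ ^ 2 := pow_le_pow_left₀ (hnn r) hτ 2
  have hnA : ‖L₂‖ ^ 2 ≤ ‖A‖ := by
    rw [hL₂.norm_sq]; exact norm_block22_le A
  have hL₂L : ∀ L : Matrix (Fin (m + n)) (Fin (m + n)) ℝ, A = L * Lᵀ → ‖L₂‖ ≤ ‖L‖ := by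
    intro L hL
    refine le_of_sq_le_sq ?_ (norm_nonneg L)
    rwa [← norm_mul_transpose_self L, ← hL]
  have hL₂pos : 0 < ‖L₂‖ := by
    refine norm_pos_iff.2 fun h => ?_
    have := hL₂.diag_pos ⟨0, hn⟩
    simp [h] at this
  refine ⟨?_, ?_, ?_⟩
  · rw [htrunc, conjDiag_posDef_iff hV]
    exact hd'pos
  · intro D hD Lt At hLt hAt'
    refine ⟨⟨glue 0 0 0 (L₂ * (truncGram C V (hr.trans (min_le_right m n)) - (1 - Cᵀ * C)) * L₂ᵀ),
      ?_, ?_, ?_, hsqτ⟩, ?_⟩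
    · rw [hAt', hLt]
      exact factor_mul_transpose hAt hL₁ hL₂ hC hD.eq_mul.symm
    · refine glue_zero_posSemidef ?_
      rw [← fullGram_eq_one_sub hUV, htrunc, hfull, conjDiag_sub,
        ← Matrix.conjTranspose_eq_transpose_of_trivial]
      refine (conjDiag_posSemidef fun j => ?_).mul_mul_conjTranspose_same L₂
      simp only [Pi.sub_apply]
      split_ifs
      · simp
      · linarith [sq_nonneg (σ j)]
    · refine div_le_of_le_mul₀ (norm_nonneg A) (sq_nonneg _) ?_
      rw [← fullGram_eq_one_sub hUV, htrunc, hfull, conjDiag_sub]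
      refine (norm_glue_zero_le _).trans ?_
      set K := conjDiag V _ with hK
      have hKn : ‖K‖ ≤ σ r ^ 2 := by
        refine norm_conjDiag_le hV' (sq_nonneg _) fun j => ?_
        simp only [Pi.sub_apply]
        split_ifs with h
        · simpa using sq_nonneg (σ r)
        · have := pow_le_pow_left₀ (hnn j) (hanti (not_lt.1 h)) 2
          rw [abs_of_nonneg (by linarith [sq_nonneg (σ j)])]
          linarith
      calc ‖L₂ * K * L₂ᵀ‖ ≤ ‖L₂‖ * ‖K‖ * ‖L₂ᵀ‖ :=
            (Matrix.l2_opNorm_mul _ _).trans (by gcongr; exact Matrix.l2_opNorm_mul _ _)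
        _ = ‖K‖ * ‖L₂‖ ^ 2 := by rw [norm_transpose]; ring
        _ ≤ σ r ^ 2 * ‖A‖ := by gcongr
    · intro L hL
      obtain ⟨D₂, hD₂⟩ := exists_isCholesky hschur
      have hLeq : L = factor L₁ L₂ C D₂ := by
        refine IsCholesky.unique (H := A) ⟨factor_lower C hL₁.lower hL₂.lower hD₂.lower,
          factor_diag_pos C hL₁.diag_pos hL₂.lower hL₂.diag_pos hD₂.lower hD₂.diag_pos, ?_⟩ hL
        rw [factor_mul_transpose hAt hL₁ hL₂ hC hD₂.eq_mul.symm, fullGram_eq_one_sub hUV, sub_self,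
          Matrix.mul_zero, Matrix.zero_mul, glue_zero, add_zero]
      have hσn : (if n ≤ m then σ (n - 1) else 0) = σ (n - 1) := by
        split_ifs with h
        · rfl
        · rw [hσ, sv_eq_zero_of_le C (by omega)]
      rw [hfull] at hD₂
      rw [htrunc] at hD
      have hgap := norm_cholesky_trunc_sub_le hn hV hV' hanti hnn hσ0 hD₂ hD
      have hb : 0 < 1 - σ 0 ^ 2 := hdpos ⟨0, hn⟩
      rw [hσn]
      set c := (1 + 2 * (⌈Real.logb 2 n⌉₊ : ℝ)) * √(1 - σ (n - 1) ^ 2) / (1 - σ 0 ^ 2)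
      have hc : 0 ≤ c := by positivity
      refine div_le_of_le_mul₀ (norm_nonneg L) (by positivity) ?_
      calc ‖Lt - L‖ ≤ ‖L₂ * (D - D₂)‖ := by
            rw [hLt, hLeq, factor_sub_factor]
            exact norm_glue_zero_le _
        _ ≤ ‖L₂‖ * ‖D - D₂‖ := Matrix.l2_opNorm_mul _ _
        _ ≤ ‖L‖ * (c * τ ^ 2) := by
            gcongr
            · exact hL₂L L hL.eq_mul
            · exact hgap.trans (by gcongr)
        _ = c * τ ^ 2 * ‖L‖ := mul_comm _ _
  · intro Lt L hLt hL
    rw [← factor_eq] at hL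
    have hAL : A = L * Lᵀ := by
      rw [hL, factor_mul_transpose hAt hL₁ hL₂ hC (W := fullGram C V), fullGram_eq_one_sub hUV,
        sub_self, Matrix.mul_zero, Matrix.zero_mul, glue_zero, add_zero]
      rw [hfull, sqrt_conjDiag hV' fun j => (hdpos j).le, conjDiag_transpose, conjDiag_mul hV']
      congr 1
      exact funext fun j => Real.mul_self_sqrt (hdpos j).le
    refine ⟨hAL, fun hτ0 => ?_⟩
    have hLpos : 0 < ‖L‖ := hL₂pos.trans_le (hL₂L L hAL)
    have hσr : σ r ^ 2 < 1 := by
      have := hanti (Nat.zero_le r)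
      nlinarith [hnn r]
    -- `1 - √(1 - x) < x` for `0 < x < 1`; for `x = 0` the strictness comes from `0 < τ`.
    have hq : 1 - √(1 - σ r ^ 2) < τ ^ 2 := by
      have hs := Real.sq_sqrt (show 0 ≤ 1 - σ r ^ 2 by linarith)
      have hs0 : 0 < √(1 - σ r ^ 2) := Real.sqrt_pos.2 (by linarith)
      rcases (hnn r).eq_or_lt with h | h
      · rw [← h]
        simpa using pow_pos hτ0 2
      · have : 0 < σ r ^ 2 := by positivity
        nlinarith
    have hq0 : 0 ≤ 1 - √(1 - σ r ^ 2) := by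
      rw [sub_nonneg, Real.sqrt_le_one]
      linarith [sq_nonneg (σ r)]
    rw [div_lt_iff₀ hLpos]
    calc ‖Lt - L‖ ≤ ‖L₂ * (CFC.sqrt (truncGram C V (hr.trans (min_le_right m n))) -
            CFC.sqrt (fullGram C V))‖ := by
          rw [hLt, hL, factor_sub_factor]
          exact norm_glue_zero_le _
      _ ≤ ‖L₂‖ * (1 - √(1 - σ r ^ 2)) := by
          refine (Matrix.l2_opNorm_mul _ _).trans ?_
          gcongr
          rw [htrunc, hfull, sqrt_conjDiag hV' fun j => (hdpos j).le,
            sqrt_conjDiag hV' fun j => (hd'pos j).le, conjDiag_sub]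
          refine norm_conjDiag_le hV' hq0 fun j => ?_
          simp only [Pi.sub_apply]
          split_ifs with h
          · simpa using hq0
          · have h2 := pow_le_pow_left₀ (hnn j) (hanti (not_lt.1 h)) 2
            have h3 : √(1 - σ r ^ 2) ≤ √(1 - σ j ^ 2) := Real.sqrt_le_sqrt (by linarith)
            have h4 : √(1 - σ j ^ 2) ≤ 1 := by
              rw [Real.sqrt_le_one]
              linarith [sq_nonneg (σ j)]
            rw [sub_zero, Real.sqrt_one, abs_of_nonneg (by linarith)]
            linarith
      _ < ‖L₂‖ * τ ^ 2 := by gcongr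
      _ ≤ τ ^ 2 * ‖L‖ := by
          rw [mul_comm]
          gcongr
          exact hL₂L L hAL
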